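/- Let $\mathcal A$ be a finite alphabet, let $\Omega_1,\Omega_2\subseteq\mathcal A^{\mathbb N}$ be subshifts (closed, shift-invariant sets), and let $p_1,p_2\ge 2$ be integers. For $p\ge 2$ and a subshift $\Omega$ put $$X_\Omega^p=\{(x_n)_{n\ge1}\in\mathcal A^{\mathbb N}:\ (x_{ip^l})_{l\ge 0}\in\Omega\ \text{ for all } i\ge 1 \text{ with } p\nmid i\},\qquad \mathcal I_p=\{i\ge 1: p\nmid i\}.$$ Let $T^2$ be the binary tree, i.e. the free monoid generated by $f_1,f_2$ with unit $\epsilon$ (the root), let $|g|$ be the word length of $g$, and let $\Delta_n=\{g\in T^2:|g|\le n\}$. For $\Lambda\subseteq T^2$ and $X\subseteq\mathcal A^{T^2}$ let $\mathcal P(\Lambda,X)=\{(x_g)_{g\in\Lambda}:x\in X\}$. The entropy of $X$ is $h(X)=\lim_{n\to\infty}\log|\mathcal P(\Delta_n,X)|/|\Delta_n|$. The axial products on $T^2$ are $$\Omega_1\times\Omega_2=\{x\in\mathcal A^{T^2}:\ (x_{gf_s^j})_{j\ge0}\in\Omega_s\ \ \forall g\in T^2,\ s\in\{1,2\}\},$$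 $$X_{\Omega_1}^{p_1}\times X_{\Omega_2}^{p_2}=\{x\in\mathcal A^{T^2}:\ (x_{gf_s^j})_{j\ge0}\in X_{\Omega_s}^{p_s}\ \ \forall g\in T^2,\ s\in\{1,2\}\text{ such that the word } g \text{ does not end in } f_s\}.$$ The type of a vertex $g$ is the pair $(i,j)$ such that $f_1^{i-1}$ is the longest power of $f_1$, and $f_2^{j-1}$ the longest power of $f_2$, in which the word $g$ ends; so $g$ has position $i$ (resp. $j$) on the maximal line in direction $f_1$ (resp. $f_2$) through it, and $i=1$ or $j=1$. A vertex at position $a$ of a line in direction $f_s$ has as its immediate dependent in direction $f_s$ the vertex at position $p_sa$ of the same line. Starting from $g$ and taking immediate dependents repeatedly, one obtains the vertices dependent on $g$ (including $g$), arranged in a binary tree and so labelled by the elements of $T^2$: $g$ is labelled $\epsilon$, and if $v$ is labelled $h$, then the immediate dependent of $v$ in direction $f_s$ is labelled $hf_s$. For $g$ of type $(i,j)$ and $k\ge0$, let $\Delta_k^{(i,j)}\subseteq T^2$ be the finite set of labels of those vertices dependent on $g$ that lie in $g\Delta_k=\{gg':g'\in\Delta_k\}$; it depends only on the type of $g$.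 Then the entropy of $X_{\Omega_1}^{p_1}\times X_{\Omega_2}^{p_2}$ exists (as a limit), both double series below converge, and $$h\left(X_{\Omega_1}^{p_1}\times X_{\Omega_2}^{p_2}\right)=\sum_{k=0}^{\infty}\sum_{\substack{i>1\\ i\in\mathcal I_{p_1}}}\frac{\log\left|\mathcal P\left(\Delta_k^{(i,1)},\Omega_1\times\Omega_2\right)\right|}{2^{k+i+1}}+\sum_{k=0}^{\infty}\sum_{\substack{j>1\\ j\in\mathcal I_{p_2}}}\frac{\log\left|\mathcal P\left(\Delta_k^{(1,j)},\Omega_1\times\Omega_2\right)\right|}{2^{k+j+1}}.$$ (Should $\Omega_1\times\Omega_2$ be empty, the identity is read with $\log 0=0$.) -/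

import Mathlib

noncomputable section

namespace AxialProduct

open Filter Topology

/-- The conventional binary tree `T²`: the free monoid on two generators `f 0`, `f 1`
(the mathematical `f₁`, `f₂`), with unit the root. -/
abbrev T2 : Type := FreeMonoid (Fin 2)

/-- The generators of `T²`. -/
abbrev f (s : Fin 2) : T2 := FreeMonoid.of s

/-- `Δₙ`: the vertices at distance at most `n` from the root. -/
def ball (n : ℕ) : Set T2 := {g | g.length ≤ n}

/-- The end generator `e(g)` of a vertex, as an index (`none` for the root). -/
def endGen (g : T2) : Option (Fin 2) := g.toList.getLast?

/-- The set `𝒫(Λ, X)` of projections to `A^Λ` of the elements of `X`. -/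
def patterns {A G : Type*} (Λ : Set G) (X : Set (G → A)) : Set (Λ → A) :=
  (fun x (g : Λ) => x g) '' X

/-- The multiplicative subshift `X_Ω^p`. A sequence indexed by the positive integers
`x₁, x₂, …` is coded as a function on `ℕ` whose value at `n` is the entry `x_{n+1}`, so that
`x_{i p^l}` is the value at `i * p ^ l - 1`. -/
def multSubshift {A : Type*} (p : ℕ) (Ω : Set (ℕ → A)) : Set (ℕ → A) :=
  {x | ∀ i : ℕ, 1 ≤ i → ¬ p ∣ i → (fun l : ℕ => x (i * p ^ l - 1)) ∈ Ω}

/-- The axial product on `T²` of two subshifts: the sequences read along each generator, started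
at any vertex, belong to the corresponding subshift. -/
def axialProduct {A : Type*} (X : Fin 2 → Set (ℕ → A)) : Set (T2 → A) :=
  {x | ∀ (g : T2) (s : Fin 2), (fun j : ℕ => x (g * f s ^ j)) ∈ X s}

/-- The axial product on `T²` of two multiplicative subshifts. As these are not shift invariant,
a line in the direction `f s` is read only from its initial vertex, that is, from a
vertex `g` whose end generator is not `f s`. -/
def multAxialProduct {A : Type*} (X : Fin 2 → Set (ℕ → A)) : Set (T2 → A) :=
  {x | ∀ (g : T2) (s : Fin 2), endGen g ≠ some s → (fun j : ℕ => x (g * f s ^ j)) ∈ X s}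

/-- `h` is the entropy of `X ⊆ A^{T²}`: the limit of `log |𝒫(Δₙ, X)| / |Δₙ|` exists and
equals `h`. -/
def HasTreeEntropy {A : Type*} (X : Set (T2 → A)) (h : ℝ) : Prop :=
  Tendsto (fun n : ℕ => Real.log ((patterns (ball n) X).ncard : ℝ) / ((ball n).ncard : ℝ))
    atTop (𝓝 h)

/-- The type of a vertex: its `s`-th component is the position (counted from `1`) of `g` on the
maximal line in the direction `f s` that contains `g`. Hence the root has type `(1,1)`, a vertex
`f₁^{i-1}` or `⋯ f₂ f₁^{i-1}`, with `i > 1`, has type `(i,1)`, and symmetrically. -/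
def vertexType (g : T2) (s : Fin 2) : ℕ :=
  (g.toList.rtakeWhile (fun t => decide (t = s))).length + 1

/-- The immediate dependent of a vertex `v` in the direction `f s` under the multiplicative
constraints `p`: if `v` is at position `a` of its `f s`-line, it is the vertex
at position `p s * a` of that line. -/
def nextDependent (p : Fin 2 → ℕ) (v : T2) (s : Fin 2) : T2 :=
  v * f s ^ ((p s - 1) * vertexType v s)

/-- The vertices dependent on `g` form a binary tree rooted at `g`, a vertex `v` being joined to
its two immediate dependents. `dependentVertex p g h` is the vertex that occupies place `h`
of that tree. -/
def dependentVertex (p : Fin 2 → ℕ) (g h : T2) : T2 :=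
  h.toList.foldl (nextDependent p) g

/-- The vertices in `g Δₖ` that are dependent on `g`, reshaped into a subset of `T²`. -/
def dependentShape (p : Fin 2 → ℕ) (g : T2) (k : ℕ) : Set T2 :=
  {h | ∃ g' ∈ ball k, dependentVertex p g h = g * g'}

/-- `Δₖ^τ` with respect to the multiplicative constraints `p`: the reshaped set of the vertices
in `g Δₖ` that are dependent on `g`, where `g` is a vertex of type `τ`. The choice of `g` does not
matter, see `shape_eq_dependentShape`. -/
def shape (p : Fin 2 → ℕ) (τ : Fin 2 → ℕ) (k : ℕ) : Set T2 :=
  ⋃ g ∈ {g : T2 | vertexType g = τ}, dependentShape p g k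

theorem vertexType_mul_f (g : T2) (s t : Fin 2) :
    vertexType (g * f s) t = if s = t then vertexType g t + 1 else 1 := by
  unfold vertexType
  rw [FreeMonoid.toList_mul, FreeMonoid.toList_of, List.rtakeWhile_concat]
  by_cases h : s = t <;> simp [h]

theorem vertexType_mul_f_pow (g g' : T2) (h : vertexType g = vertexType g') (s : Fin 2) (m : ℕ) :
    vertexType (g * f s ^ m) = vertexType (g' * f s ^ m) := by
  induction m with
  | zero => simpa using h
  | succ m ih =>
    funext t
    rw [pow_succ, ← mul_assoc, ← mul_assoc, vertexType_mul_f, vertexType_mul_f, ih]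

theorem exists_dependentVertex_eq (p : Fin 2 → ℕ) (h : T2) (g g' : T2)
    (hg : vertexType g = vertexType g') :
    ∃ w, dependentVertex p g h = g * w ∧ dependentVertex p g' h = g' * w := by
  unfold dependentVertex
  generalize h.toList = l
  induction l generalizing g g' with
  | nil => exact ⟨1, by simp, by simp⟩
  | cons s l ih =>
    obtain ⟨w, h1, h2⟩ := ih (nextDependent p g s) (nextDependent p g' s) (by
      unfold nextDependent
      rw [hg]
      exact vertexType_mul_f_pow g g' hg s _)
    refine ⟨f s ^ ((p s - 1) * vertexType g s) * w, ?_, ?_⟩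
    · rw [List.foldl_cons, h1, nextDependent, mul_assoc]
    · rw [List.foldl_cons, h2, nextDependent, mul_assoc, hg]

theorem dependentShape_subset (p : Fin 2 → ℕ) {g g' : T2} (hg : vertexType g = vertexType g')
    (k : ℕ) : dependentShape p g k ⊆ dependentShape p g' k := by
  rintro h ⟨v, hv, e⟩
  obtain ⟨w, h1, h2⟩ := exists_dependentVertex_eq p h g g' hg
  have : w = v := mul_left_cancel (h1.symm.trans e)
  exact ⟨v, hv, this ▸ h2⟩

/-- `Δₖ^τ` may be computed from any vertex `g` of type `τ`. -/
theorem shape_eq_dependentShape (p : Fin 2 → ℕ) (g : T2) (k : ℕ) :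
    shape p (vertexType g) k = dependentShape p g k := by
  apply Set.Subset.antisymm
  · exact Set.iUnion₂_subset fun g' hg' => dependentShape_subset p hg' k
  · exact Set.subset_biUnion_of_mem (u := fun g => dependentShape p g k) rfl

theorem length_le_dependentVertex (p : Fin 2 → ℕ) (hp : ∀ s, 2 ≤ p s) (g h : T2) :
    g.length + h.length ≤ (dependentVertex p g h).length := by
  unfold dependentVertex
  have : h.length = h.toList.length := rfl
  rw [this]
  generalize h.toList = l
  induction l generalizing g with
  | nil => simp
  | cons s l ih =>
    have h1 := ih (nextDependent p g s)
    have hl : ∀ m : ℕ, (f s ^ m).length = m := by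
      intro m
      induction m with
      | zero => rfl
      | succ m ihm => rw [pow_succ, FreeMonoid.length_mul, ihm, FreeMonoid.length_of]
    have h2 : 1 ≤ (p s - 1) * vertexType g s :=
      Nat.mul_pos (by have := hp s; omega) (Nat.succ_pos _)
    rw [nextDependent, FreeMonoid.length_mul, hl] at h1
    rw [List.foldl_cons, List.length_cons, nextDependent]
    omega

theorem finite_ball (n : ℕ) : (ball n).Finite :=
  List.finite_length_le (Fin 2) n

/-- The sets `Δₖ^τ` are finite, so that the number of patterns on them is a genuine one. -/
theorem finite_shape (p : Fin 2 → ℕ) (hp : ∀ s, 2 ≤ p s) (τ : Fin 2 → ℕ) (k : ℕ) :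
    (shape p τ k).Finite := by
  refine (finite_ball k).subset (Set.iUnion₂_subset fun g _ => ?_)
  rintro h ⟨v, hv, e⟩
  have h1 := length_le_dependentVertex p hp g h
  rw [e, FreeMonoid.length_mul] at h1
  change v.length ≤ k at hv
  change h.length ≤ k
  omega

/-- The summand `2^{-(k+i+1)} log |𝒫(Δₖ^τ, Ω₁ × Ω₂)|`, where `i` is the
component of `τ` in the direction considered. -/
def entropyTerm {A : Type*} (p : Fin 2 → ℕ) (Ω : Fin 2 → Set (ℕ → A)) (τ : Fin 2 → ℕ)
    (i k : ℕ) : ℝ :=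
  1 / 2 ^ (k + i + 1) * Real.log ((patterns (shape p τ k) (axialProduct Ω)).ncard : ℝ)

end AxialProduct

end

/-!
Call a vertex of the binary tree a source if it is the immediate dependent of no other vertex.
An immediate dependent determines the vertex and the direction it comes from, since its position is
greater than `1` in that direction only (`nextDependent_inj`). So every vertex is
dependent on exactly one source: the binary tree is partitioned into the dependent trees of the
sources, each a copy of it (`sourceEquiv`). As the subshifts are shift invariant, `x` belongs to the
axial product of the multiplicative subshifts exactly when its restriction to each dependent tree
belongs to `Ω₁ × Ω₂` (`mem_multAxialProduct_iff`). Hence `log |𝒫(Δₙ, X)|` is the sum of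
`log |𝒫(Δₖ^τ, Ω₁ × Ω₂)|` over the sources in `Δₙ`, where `τ` is the type of the source and `k` its
distance to the boundary (`log_ncard_patterns_ball`).

Except for the root, the sources are the vertices at a position `i > 1` with `p s ∤ i` in one of
the directions `f s`. Among the vertices of `Δₙ`, those at position `i` and distance `k` from the
boundary have density tending to `1 / 2 ^ (k + i + 1)` and at most four times this number
(`tendsto_positionCount_div`, `positionCount_div_le`), so that dominated convergence gives the limit
(`tendsto_lineSum_div`) as soon as the series converges. Convergence requires no estimate of `Δₖ^τ`:
a summand is at most `|Δₖ^τ| log |A|` times the density, and since the dependent trees are disjoint,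
the averages of `|Δₖ^τ|` over `Δₙ` are at most `1`, whence the weighted sum of the `|Δₖ^τ|` is
finite by Fatou's lemma (`summable_ncard_shape`). The same summability shows that the contribution
of the root is negligible (`tendsto_ncard_shape_one_div`).
-/

noncomputable section

namespace AxialProduct

open Filter Topology

/-! ### Lines and positions -/

theorem vertexType_pos (g : T2) (s : Fin 2) : 1 ≤ vertexType g s := Nat.succ_pos _

theorem vertexType_one (s : Fin 2) : vertexType 1 s = 1 := rfl

theorem vertexType_mul_f_pow_self (g : T2) (s : Fin 2) (m : ℕ) :
    vertexType (g * f s ^ m) s = vertexType g s + m := by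
  induction m with
  | zero => simp
  | succ m ih => rw [pow_succ, ← mul_assoc, vertexType_mul_f, if_pos rfl, ih, add_assoc]

theorem vertexType_mul_f_pow_of_ne (g : T2) {s t : Fin 2} (h : s ≠ t) {m : ℕ} (hm : m ≠ 0) :
    vertexType (g * f s ^ m) t = 1 := by
  obtain ⟨m, rfl⟩ := Nat.exists_eq_succ_of_ne_zero hm
  rw [pow_succ, ← mul_assoc, vertexType_mul_f, if_neg h]

theorem length_f_pow (s : Fin 2) (m : ℕ) : (f s ^ m).length = m := by
  induction m with
  | zero => rfl
  | succ m ih => rw [pow_succ, FreeMonoid.length_mul, ih, FreeMonoid.length_of]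

/-- Induction on words by appending generators on the right. -/
theorem word_induction {P : T2 → Prop} (one : P 1) (mul_f : ∀ g s, P g → P (g * f s)) (g : T2) :
    P g :=
  List.reverseRecOn (motive := fun l => P (FreeMonoid.ofList l)) g.toList one
    fun l s h => mul_f (FreeMonoid.ofList l) s h

theorem endGen_mul_f (g : T2) (s : Fin 2) : endGen (g * f s) = some s := by
  simp [endGen, FreeMonoid.toList_mul]

theorem vertexType_eq_one_of_endGen_ne {g : T2} {s : Fin 2} (h : endGen g ≠ some s) :
    vertexType g s = 1 := by
  induction g using word_induction with
  | one => rfl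
  | mul_f g t _ =>
    rw [endGen_mul_f] at h
    rw [vertexType_mul_f, if_neg fun e => h (congrArg some e)]

/-- Every vertex is reached from the initial vertex of its line in the direction `f s`. -/
theorem exists_line_start (g : T2) (s : Fin 2) :
    ∃ u, endGen u ≠ some s ∧ g = u * f s ^ (vertexType g s - 1) := by
  induction g using word_induction with
  | one => exact ⟨1, by simp [endGen], by simp [vertexType_one]⟩
  | mul_f g t ih =>
    by_cases h : t = s
    · subst h
      obtain ⟨u, hu, e⟩ := ih
      refine ⟨u, hu, ?_⟩
      have := vertexType_pos g t
      rw [vertexType_mul_f, if_pos rfl, Nat.add_sub_cancel,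
        ← Nat.sub_add_cancel this, pow_succ, ← mul_assoc, ← e]
    · refine ⟨g * f t, by rw [endGen_mul_f]; exact fun e => h (Option.some.inj e), ?_⟩
      rw [vertexType_mul_f, if_neg h]
      simp

/-- A vertex off the beginning of its line in one direction begins its line in the other. -/
theorem vertexType_eq_one_of_one_lt {g : T2} {s t : Fin 2} (hst : s ≠ t)
    (h : 1 < vertexType g s) : vertexType g t = 1 := by
  obtain ⟨u, -, e⟩ := exists_line_start g s
  rw [e]
  exact vertexType_mul_f_pow_of_ne u hst (by omega)

theorem eq_one_of_vertexType {g : T2} (h : ∀ s, vertexType g s = 1) : g = 1 := by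
  induction g using word_induction with
  | one => rfl
  | mul_f g t _ =>
    have h1 := h t
    have h2 := vertexType_pos g t
    rw [vertexType_mul_f, if_pos rfl] at h1
    omega

/-! ### The forest of dependent vertices -/

variable {p : Fin 2 → ℕ}

theorem vertexType_nextDependent_self (hp : ∀ s, 2 ≤ p s) (v : T2) (s : Fin 2) :
    vertexType (nextDependent p v s) s = p s * vertexType v s := by
  rw [nextDependent, vertexType_mul_f_pow_self]
  obtain ⟨q, hq⟩ : ∃ q, p s = q + 1 := ⟨p s - 1, by have := hp s; omega⟩
  rw [hq, Nat.add_sub_cancel]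
  ring

theorem vertexType_nextDependent_of_ne (hp : ∀ s, 2 ≤ p s) (v : T2) {s t : Fin 2} (h : s ≠ t) :
    vertexType (nextDependent p v s) t = 1 :=
  vertexType_mul_f_pow_of_ne v h
    (Nat.mul_pos (by have := hp s; omega) (vertexType_pos v s)).ne'

theorem one_lt_vertexType_nextDependent (hp : ∀ s, 2 ≤ p s) (v : T2) (s : Fin 2) :
    1 < vertexType (nextDependent p v s) s := by
  rw [vertexType_nextDependent_self hp]
  have := hp s
  have := vertexType_pos v s
  nlinarith

theorem nextDependent_inj (hp : ∀ s, 2 ≤ p s) {v v' : T2} {s s' : Fin 2}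
    (h : nextDependent p v s = nextDependent p v' s') : v = v' ∧ s = s' := by
  have hs : s = s' := by
    by_contra hne
    have h1 := one_lt_vertexType_nextDependent hp v s
    rw [h, vertexType_nextDependent_of_ne hp v' (Ne.symm hne)] at h1
    omega
  subst hs
  have ht : vertexType v s = vertexType v' s := by
    have h1 := congrArg (fun g => vertexType g s) h
    simp only [vertexType_nextDependent_self hp] at h1
    exact Nat.eq_of_mul_eq_mul_left (by have := hp s; omega) h1
  rw [nextDependent, nextDependent, ht] at h
  exact ⟨mul_right_cancel h, rfl⟩

theorem dependentVertex_one (g : T2) : dependentVertex p g 1 = g := rfl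

theorem dependentVertex_mul_f (g h : T2) (s : Fin 2) :
    dependentVertex p g (h * f s) = nextDependent p (dependentVertex p g h) s := by
  simp [dependentVertex, FreeMonoid.toList_mul, List.foldl_append]

theorem dependentVertex_f_mul (g h : T2) (s : Fin 2) :
    dependentVertex p g (f s * h) = dependentVertex p (nextDependent p g s) h := by
  simp [dependentVertex, FreeMonoid.toList_mul]

/-- Taking `j` dependents in the direction `f s` multiplies the position on the line
by `p s ^ j`. -/
theorem dependentVertex_mul_f_pow (hp : ∀ s, 2 ≤ p s) (g h : T2) (s : Fin 2) {u : T2}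
    (hu : endGen u ≠ some s) {a : ℕ} (ha : 1 ≤ a) (e : dependentVertex p g h = u * f s ^ (a - 1))
    (j : ℕ) : dependentVertex p g (h * f s ^ j) = u * f s ^ (a * p s ^ j - 1) := by
  induction j with
  | zero => simpa using e
  | succ j ih =>
    have hb : 1 ≤ a * p s ^ j := Nat.mul_pos ha (Nat.pow_pos (by have := hp s; omega))
    rw [pow_succ, ← mul_assoc, dependentVertex_mul_f, ih, nextDependent,
      vertexType_mul_f_pow_self, vertexType_eq_one_of_endGen_ne hu, mul_assoc, ← pow_add]
    congr 2
    obtain ⟨q, hq⟩ : ∃ q, p s = q + 1 := ⟨p s - 1, by have := hp s; omega⟩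
    obtain ⟨b, hb'⟩ : ∃ b, a * p s ^ j = b + 1 := ⟨a * p s ^ j - 1, by omega⟩
    rw [pow_succ, ← mul_assoc, hb', hq]
    have : (b + 1) * (q + 1) = b + q * (b + 1) + 1 := by ring
    rw [this, Nat.add_sub_cancel, Nat.add_sub_cancel, Nat.add_sub_cancel, add_comm 1 b]

/-- The vertices that are the immediate dependent of no vertex: the roots of the forest of
dependent vertices. -/
def IsSource (p : Fin 2 → ℕ) (g : T2) : Prop := ∀ s, ¬ p s ∣ vertexType g s

theorem isSource_one (hp : ∀ s, 2 ≤ p s) : IsSource p 1 := fun s h => by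
  have := Nat.le_of_dvd one_pos h
  have := hp s
  omega

theorem exists_eq_nextDependent_of_not_isSource {v : T2}
    (hv : ¬ IsSource p v) : ∃ w s, v = nextDependent p w s := by
  simp only [IsSource, not_forall, not_not] at hv
  obtain ⟨s, b, hb⟩ := hv
  obtain ⟨u, hu, e⟩ := exists_line_start v s
  have hpos := vertexType_pos v s
  have hb0 : b ≠ 0 := by rintro rfl; omega
  refine ⟨u * f s ^ (b - 1), s, ?_⟩
  rw [nextDependent, vertexType_mul_f_pow_self, vertexType_eq_one_of_endGen_ne hu, mul_assoc,
    ← pow_add]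
  rw [hb] at e hpos
  refine e.trans ?_
  congr 2
  obtain ⟨q, hq⟩ : ∃ q, p s = q + 1 :=
    ⟨p s - 1, by have := Nat.pos_of_ne_zero (fun h : p s = 0 => by simp [h] at hpos); omega⟩
  obtain ⟨c, rfl⟩ := Nat.exists_eq_succ_of_ne_zero hb0
  rw [hq]
  have : (q + 1) * (c + 1) = c + q * (1 + c) + 1 := by ring
  simp only [Nat.succ_eq_add_one, this, Nat.add_sub_cancel]

theorem not_isSource_nextDependent (hp : ∀ s, 2 ≤ p s) (v : T2) (s : Fin 2) :
    ¬ IsSource p (nextDependent p v s) := fun h =>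
  h s (vertexType_nextDependent_self hp v s ▸ dvd_mul_right _ _)

theorem exists_source (hp : ∀ s, 2 ≤ p s) (v : T2) :
    ∃ g h, IsSource p g ∧ dependentVertex p g h = v := by
  induction hn : v.length using Nat.strong_induction_on generalizing v with
  | _ n ih =>
    by_cases hv : IsSource p v
    · exact ⟨v, 1, hv, rfl⟩
    · obtain ⟨w, s, rfl⟩ := exists_eq_nextDependent_of_not_isSource hv
      have hlt : w.length < n := by
        rw [← hn, nextDependent, FreeMonoid.length_mul, length_f_pow]
        have : 0 < (p s - 1) * vertexType w s :=
          Nat.mul_pos (by have := hp s; omega) (vertexType_pos w s)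
        omega
      obtain ⟨g, h, hg, rfl⟩ := ih _ hlt w rfl
      exact ⟨g, h * f s, hg, dependentVertex_mul_f g h s⟩

theorem dependentVertex_inj (hp : ∀ s, 2 ≤ p s) {g g' h h' : T2} (hg : IsSource p g)
    (hg' : IsSource p g') (e : dependentVertex p g h = dependentVertex p g' h') :
    g = g' ∧ h = h' := by
  induction h using word_induction generalizing h' with
  | one =>
    induction h' using word_induction with
    | one => exact ⟨e, rfl⟩
    | mul_f h' t _ =>
      rw [dependentVertex_one, dependentVertex_mul_f] at e
      exact absurd (e ▸ hg) (not_isSource_nextDependent hp _ _)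
  | mul_f h s ih =>
    induction h' using word_induction with
    | one =>
      rw [dependentVertex_one, dependentVertex_mul_f] at e
      exact absurd (e ▸ hg') (not_isSource_nextDependent hp _ _)
    | mul_f h' t _ =>
      rw [dependentVertex_mul_f, dependentVertex_mul_f] at e
      obtain ⟨e1, rfl⟩ := nextDependent_inj hp e
      obtain ⟨rfl, rfl⟩ := ih e1
      exact ⟨rfl, rfl⟩

/-- The dependent trees of the sources partition the binary tree, each of them being a copy of
it. -/
def sourceEquiv (hp : ∀ s, 2 ≤ p s) : {g // IsSource p g} × T2 ≃ T2 :=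
  Equiv.ofBijective (fun x => dependentVertex p x.1 x.2) <| by
    refine ⟨fun x y e => ?_, fun v => ?_⟩
    · obtain ⟨h1, h2⟩ := dependentVertex_inj hp x.1.2 y.1.2 e
      exact Prod.ext (Subtype.ext h1) h2
    · obtain ⟨g, h, hg, e⟩ := exists_source hp v
      exact ⟨(⟨g, hg⟩, h), e⟩

/-- The multiplicative constraints decouple: they hold for `x` exactly when the restriction of `x`
to the dependent tree of each source satisfies the constraints of the axial product `Ω₁ × Ω₂`. -/
theorem mem_multAxialProduct_iff {A : Type*} (hp : ∀ s, 2 ≤ p s) {Ω : Fin 2 → Set (ℕ → A)}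
    (hΩ : ∀ s (m : ℕ), ∀ x ∈ Ω s, (fun n => x (m + n)) ∈ Ω s) (x : T2 → A) :
    x ∈ multAxialProduct (fun s => multSubshift (p s) (Ω s)) ↔
      ∀ g, IsSource p g → (fun h => x (dependentVertex p g h)) ∈ axialProduct Ω := by
  constructor
  · intro hx g _ h s
    obtain ⟨u, hu, e⟩ := exists_line_start (dependentVertex p g h) s
    have hpos := vertexType_pos (dependentVertex p g h) s
    obtain ⟨m, i, hi, ha⟩ := Nat.exists_eq_pow_mul_and_not_dvd (n := vertexType _ s)
      (by omega : vertexType (dependentVertex p g h) s ≠ 0) (p s) (by have := hp s; omega)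
    have hi0 : 1 ≤ i := Nat.pos_of_ne_zero fun h0 => hi (h0 ▸ dvd_zero _)
    have key := hΩ s m _ (hx u s hu i hi0 hi)
    -- The sequence to be read is the shift by `m` of the one along the class of `i` on the line.
    convert key using 2 with j
    change x _ = x _
    rw [dependentVertex_mul_f_pow hp g h s hu hpos e, ha, pow_add]
    congr 4
    ring
  · intro hx u s hu i hi0 hi
    obtain ⟨g, h, hg, e⟩ := exists_source hp (u * f s ^ (i - 1))
    have key := hx g hg h s
    simp only [dependentVertex_mul_f_pow hp g h s hu hi0 e] at key
    exact key

/-- Apart from the place of `1`, the dependent shape of the root is covered by those of any two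
vertices `g 0` and `g 1` such that `g s` begins its line in the direction `f s`: from its first
step on, a path of dependents is the same from either vertex. -/
theorem dependentShape_one_subset (hp : ∀ s, 2 ≤ p s) (g : Fin 2 → T2)
    (hg : ∀ s, vertexType (g s) s = 1) (k : ℕ) :
    dependentShape p 1 k ⊆ {1} ∪ (dependentShape p (g 0) k ∪ dependentShape p (g 1) k) := by
  rintro h ⟨v, hv, e⟩
  have main : ∀ s h', h = f s * h' → h ∈ dependentShape p (g s) k := by
    rintro s h' rfl
    have hpos : (p s - 1) * 1 ≠ 0 := by have := hp s; omega
    obtain ⟨w, h1, h2⟩ := exists_dependentVertex_eq p h' (nextDependent p 1 s)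
      (nextDependent p (g s) s) (by
        funext t
        by_cases hst : s = t
        · subst hst
          rw [vertexType_nextDependent_self hp, vertexType_nextDependent_self hp, hg,
            vertexType_one]
        · rw [vertexType_nextDependent_of_ne hp _ hst, vertexType_nextDependent_of_ne hp _ hst])
    -- Both paths start with `f s ^ (p s - 1)` and continue with the same word `w`.
    refine ⟨v, hv, ?_⟩
    rw [dependentVertex_f_mul, h1, nextDependent, vertexType_one, one_mul, one_mul] at e
    rw [dependentVertex_f_mul, h2, nextDependent, hg, mul_assoc, e]
  induction h using FreeMonoid.casesOn with
  | one => exact Or.inl rfl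
  | of_mul s h' =>
    have := main s h' rfl
    fin_cases s
    · exact Or.inr (Or.inl this)
    · exact Or.inr (Or.inr this)

/-! ### Counting patterns -/

/-- If `X` is a product of copies of `Y` along a partition of `G` into copies of `H`, then the
number of patterns of `X` is the product of the numbers of patterns of the copies of `Y`. -/
theorem ncard_patterns_eq_prod {A G H I : Type*} (e : I × H ≃ G) {X : Set (G → A)}
    {Y : Set (H → A)} (hX : ∀ x, x ∈ X ↔ ∀ i, (fun h => x (e (i, h))) ∈ Y) (hY : Y.Nonempty)
    (Λ : Set G) (J : Finset I) (hJ : ∀ i h, e (i, h) ∈ Λ → i ∈ J) :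
    (patterns Λ X).ncard = ∏ i ∈ J, (patterns {h | e (i, h) ∈ Λ} Y).ncard := by
  classical
  -- `R` splits a pattern on `Λ` into its restrictions to the pieces of the partition.
  let R : (Λ → A) → ∀ i : J, ({h | e (i, h) ∈ Λ} : Set H) → A := fun z i h => z ⟨e (i, h), h.2⟩
  have hR : Function.Injective R := by
    intro z z' hz
    funext ⟨g, hg⟩
    obtain ⟨⟨i, h⟩, rfl⟩ := e.surjective g
    exact congrFun (congrFun hz ⟨i, hJ i h hg⟩) ⟨h, hg⟩
  have himage : R '' patterns Λ X =
      Set.pi Set.univ fun i : J => patterns {h | e (i, h) ∈ Λ} Y := by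
    ext z
    constructor
    · rintro ⟨_, ⟨x, hx, rfl⟩, rfl⟩ i -
      exact ⟨_, (hX x).1 hx i, rfl⟩
    · intro hz
      choose y hy hyz using fun i => hz i (Set.mem_univ i)
      obtain ⟨y₀, hy₀⟩ := hY
      let y' : I → H → A := fun i => if hi : i ∈ J then y ⟨i, hi⟩ else y₀
      have hy' : ∀ i, y' i ∈ Y := by
        intro i
        by_cases hi : i ∈ J
        · simpa only [y', dif_pos hi] using hy ⟨i, hi⟩
        · simpa only [y', dif_neg hi] using hy₀
      refine ⟨_, ⟨fun g => y' (e.symm g).1 (e.symm g).2, (hX _).2 fun i => ?_, rfl⟩, ?_⟩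
      · simpa using hy' i
      · funext i h
        rw [← hyz i]
        simp [R, y']
  rw [← Set.ncard_image_of_injective _ hR, himage, ← Nat.card_coe_set_eq,
    Nat.card_congr (Equiv.Set.univPi _), Nat.card_pi,
    Finset.prod_coe_sort J fun i => Nat.card (patterns {h | e (i, h) ∈ Λ} Y)]
  rfl

theorem sum_ncard_preimage_eq {G H I : Type*} (e : I × H ≃ G) {Λ : Set G} (hΛ : Λ.Finite)
    (J : Finset I) (hJ : ∀ i h, e (i, h) ∈ Λ → i ∈ J) :
    ∑ i ∈ J, ({h | e (i, h) ∈ Λ} : Set H).ncard = Λ.ncard := by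
  classical
  rw [Set.ncard_eq_toFinset_card Λ hΛ, Finset.card_eq_sum_card_fiberwise
    (f := fun g => (e.symm g).1) (t := J)]
  · refine Finset.sum_congr rfl fun i _ => ?_
    rw [← Set.ncard_coe_finset,
      ← Set.ncard_image_of_injective _ (f := fun h => e (i, h)) fun a b hab => by simpa using hab]
    congr 1
    ext g
    simp only [Set.mem_image, Set.mem_ofPred_eq, Finset.coe_filter, Set.Finite.mem_toFinset]
    constructor
    · rintro ⟨h, hh, rfl⟩
      exact ⟨hh, by simp⟩
    · rintro ⟨hg, rfl⟩
      exact ⟨(e.symm g).2, by simpa using hg, by simp⟩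
  · intro g hg
    exact hJ _ (e.symm g).2 (by simpa using hg)

theorem log_ncard_patterns_nonneg {A G : Type*} (Λ : Set G) (X : Set (G → A)) :
    0 ≤ Real.log ((patterns Λ X).ncard : ℝ) := Real.log_natCast_nonneg _

theorem log_ncard_patterns_le {A G : Type*} [Finite A] {Λ : Set G} (hΛ : Λ.Finite)
    (X : Set (G → A)) :
    Real.log ((patterns Λ X).ncard : ℝ) ≤ Λ.ncard * Real.log (Nat.card A) := by
  have := hΛ.to_subtype
  have h1 : (patterns Λ X).ncard ≤ Nat.card A ^ Λ.ncard := by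
    rw [← Nat.card_coe_set_eq Λ, ← Nat.card_fun, ← Set.ncard_univ]
    exact Set.ncard_le_ncard (Set.subset_univ _)
  rcases Nat.eq_zero_or_pos (patterns Λ X).ncard with h0 | h0
  · rw [h0, Nat.cast_zero, Real.log_zero]
    exact mul_nonneg (Nat.cast_nonneg _) (Real.log_natCast_nonneg _)
  · rw [← Real.log_pow]
    exact Real.log_le_log (by exact_mod_cast h0) (by exact_mod_cast h1)

theorem patterns_empty {A G : Type*} (Λ : Set G) : patterns Λ (∅ : Set (G → A)) = ∅ :=
  Set.image_empty _

/-- The ball `Δₙ` as a finite set. -/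
def ballFinset (n : ℕ) : Finset T2 := (finite_ball n).toFinset

theorem mem_ballFinset {n : ℕ} {g : T2} : g ∈ ballFinset n ↔ g.length ≤ n :=
  (finite_ball n).mem_toFinset

theorem length_le_of_dependentVertex_mem_ball (hp : ∀ s, 2 ≤ p s) {g h : T2} {n : ℕ}
    (hn : dependentVertex p g h ∈ ball n) : g.length ≤ n := by
  have := length_le_dependentVertex p hp g h
  change (dependentVertex p g h).length ≤ n at hn
  omega

theorem dependentVertex_preimage_ball {g : T2} {n : ℕ} (hg : g.length ≤ n) :
    {h | dependentVertex p g h ∈ ball n} = dependentShape p g (n - g.length) := by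
  ext h
  obtain ⟨w, hw, -⟩ := exists_dependentVertex_eq p h g g rfl
  simp only [dependentShape, ball, Set.mem_ofPred_eq, hw, FreeMonoid.length_mul,
    mul_right_inj, exists_eq_right']
  omega

open Classical in
/-- The trace on `Δₙ` of the dependent tree of a source `g` has the shape `Δₖ^τ`, where `τ` is the
type of `g` and `k = n - |g|`, and the patterns on these traces may be chosen independently. -/
theorem log_ncard_patterns_ball {A : Type*} [Finite A] (hp : ∀ s, 2 ≤ p s) {Ω : Fin 2 → Set (ℕ → A)}
    (hΩ : ∀ s (m : ℕ), ∀ x ∈ Ω s, (fun n => x (m + n)) ∈ Ω s) (n : ℕ) :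
    Real.log ((patterns (ball n)
        (multAxialProduct fun s => multSubshift (p s) (Ω s))).ncard : ℝ) =
      ∑ g ∈ ballFinset n with IsSource p g,
        Real.log
          ((patterns (shape p (vertexType g) (n - g.length)) (axialProduct Ω)).ncard : ℝ) := by
  have hmem := mem_multAxialProduct_iff hp hΩ
  rcases (axialProduct Ω).eq_empty_or_nonempty with h0 | hne
  -- Without a point in `Ω₁ × Ω₂` both sides vanish, as `Real.log 0 = 0`.
  · have : (multAxialProduct fun s => multSubshift (p s) (Ω s)) = ∅ :=
      Set.eq_empty_of_forall_notMem fun x hx => by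
        have := (hmem x).1 hx 1 (isSource_one hp)
        rw [h0] at this
        exact this
    rw [this, h0]
    simp [patterns_empty]
  · rw [ncard_patterns_eq_prod (sourceEquiv hp) (Y := axialProduct Ω)
      (fun x => (hmem x).trans ⟨fun H i => H i.1 i.2, fun H g hg => H ⟨g, hg⟩⟩) hne (ball n)
      ((ballFinset n).subtype (IsSource p)) fun g h hg => Finset.mem_subtype.2
        (mem_ballFinset.2 (length_le_of_dependentVertex_mem_ball hp hg))]
    have hshape : ∀ g ∈ (ballFinset n).subtype (IsSource p),
        {h | sourceEquiv hp (g, h) ∈ ball n} = shape p (vertexType g) (n - g.1.length) := by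
      intro g hg
      rw [shape_eq_dependentShape]
      exact dependentVertex_preimage_ball (mem_ballFinset.1 (Finset.mem_subtype.1 hg))
    rw [Finset.prod_congr rfl fun g hg => by rw [hshape g hg], Nat.cast_prod, Real.log_prod,
      Finset.sum_subtype_eq_sum_filter (s := ballFinset n) (p := IsSource p) fun g =>
        Real.log ((patterns (shape p (vertexType g) (n - g.length)) (axialProduct Ω)).ncard : ℝ)]
    -- The logarithm of the product splits because no factor is zero.
    intro g _
    have := (finite_shape p hp (vertexType g) (n - g.1.length)).to_subtype
    exact Nat.cast_ne_zero.2
      ((Set.ncard_pos (Set.toFinite _)).2 (hne.image _)).ne'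

open Classical in
theorem sum_ncard_shape (hp : ∀ s, 2 ≤ p s) (n : ℕ) :
    ∑ g ∈ ballFinset n with IsSource p g, (shape p (vertexType g) (n - g.length)).ncard =
      (ball n).ncard := by
  rw [← sum_ncard_preimage_eq (sourceEquiv hp) (finite_ball n)
      ((ballFinset n).subtype (IsSource p)) fun g h hg => Finset.mem_subtype.2
        (mem_ballFinset.2 (length_le_of_dependentVertex_mem_ball hp hg)),
    ← Finset.sum_subtype_eq_sum_filter (s := ballFinset n) (p := IsSource p)]
  refine Finset.sum_congr rfl fun g hg => ?_
  rw [shape_eq_dependentShape, ← dependentVertex_preimage_ball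
    (mem_ballFinset.1 (Finset.mem_subtype.1 hg))]
  rfl

/-! ### Counting vertices by length and position -/

theorem finite_sphere (m : ℕ) : {g : T2 | g.length = m}.Finite :=
  (finite_ball m).subset fun _ hg => le_of_eq hg

theorem ncard_sphere (m : ℕ) : {g : T2 | g.length = m}.ncard = 2 ^ m := by
  rw [← Nat.card_coe_set_eq]
  change Nat.card (List.Vector (Fin 2) m) = 2 ^ m
  rw [Nat.card_eq_fintype_card, card_vector, Fintype.card_fin]

theorem ncard_ball (n : ℕ) : (ball n).ncard + 1 = 2 ^ (n + 1) := by
  induction n with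
  | zero =>
    have : ball 0 = {g : T2 | g.length = 0} := by ext g; simp [ball]
    rw [this, ncard_sphere]
    rfl
  | succ n ih =>
    have : ball (n + 1) = ball n ∪ {g : T2 | g.length = n + 1} := by
      ext g
      exact Nat.le_succ_iff
    rw [this, Set.ncard_union_eq _ (finite_ball n) (finite_sphere _), ncard_sphere,
      add_right_comm, ih, ← two_mul, ← pow_succ']
    refine Set.disjoint_left.2 fun g hg hg' => ?_
    change g.length ≤ n at hg
    change g.length = n + 1 at hg'
    omega

theorem ncard_ball_cast (n : ℕ) : ((ball n).ncard : ℝ) = 2 ^ (n + 1) - 1 := by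
  have := congrArg (Nat.cast (R := ℝ)) (ncard_ball n)
  push_cast at this
  linarith

theorem two_pow_le_ncard_ball (n : ℕ) : (2 : ℝ) ^ n ≤ (ball n).ncard := by
  rw [ncard_ball_cast, pow_succ]
  have : (1 : ℝ) ≤ 2 ^ n := one_le_pow₀ one_le_two
  linarith

theorem ncard_ball_pos (n : ℕ) : (0 : ℝ) < (ball n).ncard :=
  (pow_pos two_pos n).trans_le (two_pow_le_ncard_ball n)

/-- A vertex of length `m ≥ i` at position `i ≥ 1` in the direction `f s` is a word of length
`m - i` followed by the other generator and by `f s ^ (i - 1)`. -/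
theorem ncard_position_eq (s : Fin 2) {m i : ℕ} (hi : 1 ≤ i) (him : i ≤ m) :
    {g : T2 | g.length = m ∧ vertexType g s = i}.ncard = 2 ^ (m - i) := by
  have hs : s + 1 ≠ s := by fin_cases s <;> decide
  rw [← ncard_sphere (m - i), ← Set.ncard_image_of_injective {g : T2 | g.length = m - i}
    (f := fun u => u * f (s + 1) * f s ^ (i - 1))
    fun u v h => mul_right_cancel (mul_right_cancel h)]
  congr 1
  ext g
  constructor
  · rintro ⟨hm, ht⟩
    obtain ⟨u, hu, e⟩ := exists_line_start g s
    rw [ht] at e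
    rw [e, FreeMonoid.length_mul, length_f_pow] at hm
    induction u using word_induction with
    | one =>
      rw [FreeMonoid.length_one] at hm
      omega
    | mul_f u t _ =>
      rw [endGen_mul_f] at hu
      have ht : t = s + 1 := by
        have : t ≠ s := fun h => hu (congrArg some h)
        clear * - this
        decide +revert
      subst ht
      rw [FreeMonoid.length_mul, FreeMonoid.length_of] at hm
      exact ⟨u, (by omega : u.length = m - i), e.symm⟩
  · rintro ⟨u, hu, rfl⟩
    change u.length = m - i at hu
    refine ⟨?_, ?_⟩
    · rw [FreeMonoid.length_mul, FreeMonoid.length_mul, FreeMonoid.length_of, length_f_pow]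
      omega
    · rw [vertexType_mul_f_pow_self, vertexType_mul_f, if_neg hs]
      omega

theorem ncard_position_mul_le (s : Fin 2) (m : ℕ) {i : ℕ} (hi : 1 ≤ i) :
    {g : T2 | g.length = m ∧ vertexType g s = i}.ncard * 2 ^ i ≤ 2 ^ (m + 1) := by
  by_cases him : i ≤ m + 1
  · have hsub : {g : T2 | g.length = m ∧ vertexType g s = i} ⊆
        (fun u => u * f s ^ (i - 1)) '' {g : T2 | g.length = m + 1 - i} := by
      rintro g ⟨hm, ht⟩
      obtain ⟨u, -, e⟩ := exists_line_start g s
      rw [ht] at e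
      rw [e, FreeMonoid.length_mul, length_f_pow] at hm
      exact ⟨u, (by omega : u.length = m + 1 - i), e.symm⟩
    have h1 := (Set.ncard_le_ncard hsub ((finite_sphere _).image _)).trans
      (Set.ncard_image_le (finite_sphere _))
    rw [ncard_sphere] at h1
    calc _ ≤ 2 ^ (m + 1 - i) * 2 ^ i := Nat.mul_le_mul_right _ h1
      _ = 2 ^ (m + 1) := by rw [← pow_add, Nat.sub_add_cancel him]
  · have : {g : T2 | g.length = m ∧ vertexType g s = i} = ∅ := by
      refine Set.eq_empty_of_forall_notMem ?_
      rintro g ⟨hm, ht⟩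
      obtain ⟨u, -, e⟩ := exists_line_start g s
      rw [ht] at e
      rw [e, FreeMonoid.length_mul, length_f_pow] at hm
      omega
    rw [this, Set.ncard_empty, zero_mul]
    exact Nat.zero_le _

/-- The number of vertices of `Δₙ` at distance `k` from its boundary and at position `i` in the
direction `f s`. -/
def positionCount (s : Fin 2) (n k i : ℕ) : ℕ :=
  (Finset.card {g ∈ ballFinset n | n - g.length = k ∧ vertexType g s = i})

theorem positionCount_eq_ncard (s : Fin 2) {n k : ℕ} (i : ℕ) (hk : k ≤ n) :
    positionCount s n k i = {g : T2 | g.length = n - k ∧ vertexType g s = i}.ncard := by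
  rw [positionCount, ← Set.ncard_coe_finset]
  congr 1
  ext g
  simp only [Finset.coe_filter, mem_ballFinset, Set.mem_ofPred_eq]
  constructor
  · rintro ⟨h1, h2, h3⟩
    exact ⟨by omega, h3⟩
  · rintro ⟨h1, h2⟩
    exact ⟨by omega, by omega, h2⟩

theorem positionCount_eq_zero (s : Fin 2) {n k : ℕ} (i : ℕ) (hk : n < k) :
    positionCount s n k i = 0 := by
  rw [positionCount, Finset.card_eq_zero, Finset.filter_eq_empty_iff]
  rintro g - ⟨h, -⟩
  omega

theorem positionCount_div_le (s : Fin 2) (n k : ℕ) {i : ℕ} (hi : 1 ≤ i) :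
    (positionCount s n k i : ℝ) / (ball n).ncard ≤ 4 * (1 / 2 ^ (k + i + 1)) := by
  rcases lt_or_ge n k with hk | hk
  · rw [positionCount_eq_zero s i hk, Nat.cast_zero, zero_div]
    positivity
  · have h1 := ncard_position_mul_le s (n - k) hi
    rw [← positionCount_eq_ncard s i hk] at h1
    have h2 : positionCount s n k i * 2 ^ (k + i) ≤ 2 ^ (n + 1) := by
      calc positionCount s n k i * 2 ^ (k + i)
          = positionCount s n k i * 2 ^ i * 2 ^ k := by rw [pow_add]; ring
        _ ≤ 2 ^ (n - k + 1) * 2 ^ k := Nat.mul_le_mul_right _ h1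
        _ = 2 ^ (n + 1) := by rw [← pow_add]; congr 1; omega
    have h3 : (positionCount s n k i : ℝ) * 2 ^ (k + i) ≤ 2 * (ball n).ncard := by
      have h4 : (positionCount s n k i : ℝ) * 2 ^ (k + i) ≤ 2 ^ (n + 1) := by exact_mod_cast h2
      have h5 := two_pow_le_ncard_ball n
      rw [pow_succ] at h4
      linarith
    rw [div_le_iff₀ (ncard_ball_pos n), mul_one_div, div_mul_eq_mul_div,
      le_div_iff₀ (by positivity), pow_succ]
    linarith

theorem tendsto_positionCount_div (s : Fin 2) (k : ℕ) {i : ℕ} (hi : 1 ≤ i) :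
    Tendsto (fun n => (positionCount s n k i : ℝ) / (ball n).ncard) atTop
      (𝓝 (1 / 2 ^ (k + i + 1))) := by
  have h0 : Tendsto (fun n : ℕ => (1 : ℝ) - (1 / 2) ^ (n + 1)) atTop (𝓝 1) := by
    have := (tendsto_pow_atTop_nhds_zero_of_lt_one (r := (1 / 2 : ℝ)) (by norm_num)
      (by norm_num)).comp (tendsto_add_atTop_nat 1)
    simpa using this.const_sub 1
  have h1 := (h0.inv₀ one_ne_zero).const_mul ((1 : ℝ) / 2 ^ (k + i + 1))
  rw [inv_one, mul_one] at h1
  refine h1.congr' ?_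
  filter_upwards [eventually_ge_atTop (k + i)] with n hn
  have hb := (ncard_ball_pos n).ne'
  rw [ncard_ball_cast] at hb
  rw [positionCount_eq_ncard s i (by omega), ncard_position_eq s hi (by omega), ncard_ball_cast]
  obtain ⟨m, rfl⟩ := Nat.exists_eq_add_of_le hn
  have e : k + i + m - k - i = m := by omega
  have e2 : (1 : ℝ) - (1 / 2) ^ (k + i + m + 1) =
      (2 ^ (k + i + m + 1) - 1) / 2 ^ (k + i + m + 1) := by
    rw [one_div, inv_pow]
    field_simp
  rw [e, e2, inv_div]
  push_cast
  field_simp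
  ring

/-! ### Averages over the sources -/

/-- The sum over the vertices of `Δₙ` at a position `i > 1` in the direction
`f s` with `q ∤ i`, of a quantity that depends on the distance to the boundary and the position. -/
def lineSum (s : Fin 2) (q : ℕ) (F : ℕ → ℕ → ℝ) (n : ℕ) : ℝ :=
  ∑ g ∈ ballFinset n with 1 < vertexType g s ∧ ¬ q ∣ vertexType g s,
    F (n - g.length) (vertexType g s)

theorem hasSum_lineSum (s : Fin 2) (q : ℕ) (F : ℕ → ℕ → ℝ) (n : ℕ) :
    HasSum (fun x : ℕ × {i : ℕ // 1 < i ∧ ¬ q ∣ i} => positionCount s n x.1 x.2 * F x.1 x.2)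
      (lineSum s q F n) := by
  unfold lineSum
  have key := hasSum_sum (s := {g ∈ ballFinset n | 1 < vertexType g s ∧ ¬ q ∣ vertexType g s})
    (f := fun g (x : ℕ × {i : ℕ // 1 < i ∧ ¬ q ∣ i}) =>
      if n - g.length = x.1 ∧ vertexType g s = x.2 then F x.1 x.2 else 0)
    (a := fun g => F (n - g.length) (vertexType g s)) fun g hg => by
      have := hasSum_single (f := fun x : ℕ × {i : ℕ // 1 < i ∧ ¬ q ∣ i} =>
        if n - g.length = x.1 ∧ vertexType g s = x.2 then F x.1 x.2 else 0)
        (n - g.length, ⟨vertexType g s, (Finset.mem_filter.1 hg).2⟩) (by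
          rintro ⟨k, i⟩ hne
          refine if_neg ?_
          rintro ⟨h1, h2⟩
          exact hne (Prod.ext h1.symm (Subtype.ext h2.symm)))
      simpa using this
  convert key using 1
  funext x
  rw [← Finset.sum_filter, Finset.sum_const, nsmul_eq_mul, Finset.filter_filter, positionCount]
  congr 3
  refine Finset.filter_congr fun g _ => ?_
  constructor
  · rintro ⟨h1, h2⟩
    exact ⟨h2 ▸ x.2.2, h1, h2⟩
  · exact And.right

/-- Fatou's lemma: a nonnegative quantity with bounded averages over the balls is summable against
the limiting densities `1 / 2 ^ (k + i + 1)`. -/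
theorem summable_of_lineSum_le (s : Fin 2) (q : ℕ) {D : ℕ → ℕ → ℝ} (hD : ∀ k i, 0 ≤ D k i)
    (h : ∀ n, lineSum s q D n ≤ (ball n).ncard) :
    Summable fun x : ℕ × {i : ℕ // 1 < i ∧ ¬ q ∣ i} =>
      1 / 2 ^ (x.1 + x.2.1 + 1) * D x.1 x.2 := by
  refine summable_of_sum_le (c := 1) (fun x => mul_nonneg (by positivity) (hD _ _)) fun u => ?_
  have hlim := tendsto_finsetSum u fun x _ =>
    (tendsto_positionCount_div s x.1 x.2.2.1.le).mul_const (D x.1 x.2)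
  refine le_of_tendsto' hlim fun n => ?_
  calc ∑ x ∈ u, (positionCount s n x.1 x.2 : ℝ) / (ball n).ncard * D x.1 x.2
      = (∑ x ∈ u, positionCount s n x.1 x.2 * D x.1 x.2) / (ball n).ncard := by
        rw [Finset.sum_div]
        exact Finset.sum_congr rfl fun x _ => by ring
    _ ≤ lineSum s q D n / (ball n).ncard := by
        gcongr
        exact sum_le_hasSum u (fun x _ => mul_nonneg (Nat.cast_nonneg _) (hD _ _))
          (hasSum_lineSum s q D n)
    _ ≤ 1 := div_le_one_of_le₀ (h n) (ncard_ball_pos n).le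

/-- Dominated convergence for averages over the balls, the density of each class of vertices being
at most four times its limit. -/
theorem tendsto_lineSum_div (s : Fin 2) (q : ℕ) {F : ℕ → ℕ → ℝ} (hF : ∀ k i, 0 ≤ F k i)
    (hsum : Summable fun x : ℕ × {i : ℕ // 1 < i ∧ ¬ q ∣ i} =>
      1 / 2 ^ (x.1 + x.2.1 + 1) * F x.1 x.2) :
    Tendsto (fun n => lineSum s q F n / (ball n).ncard) atTop
      (𝓝 (∑' x : ℕ × {i : ℕ // 1 < i ∧ ¬ q ∣ i}, 1 / 2 ^ (x.1 + x.2.1 + 1) * F x.1 x.2)) := by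
  have key := tendsto_tsum_of_dominated_convergence (𝓕 := atTop)
    (f := fun n (x : ℕ × {i : ℕ // 1 < i ∧ ¬ q ∣ i}) =>
      (positionCount s n x.1 x.2 : ℝ) / (ball n).ncard * F x.1 x.2) (hsum.mul_left 4)
    (fun x => (tendsto_positionCount_div s x.1 x.2.2.1.le).mul_const _)
    (Eventually.of_forall fun n x => by
      rw [Real.norm_of_nonneg (mul_nonneg (by positivity) (hF _ _)), ← mul_assoc]
      exact mul_le_mul_of_nonneg_right (positionCount_div_le s n x.1 x.2.2.1.le) (hF _ _))
  refine key.congr fun n => ?_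
  rw [← ((hasSum_lineSum s q F n).div_const _).tsum_eq]
  exact tsum_congr fun x => by ring

/-- The type of a vertex at position `i` in the direction `f s` and at position `1` in the other
direction. -/
def lineType (s : Fin 2) (i : ℕ) : Fin 2 → ℕ := fun t => if t = s then i else 1

theorem vertexType_eq_lineType {g : T2} {s : Fin 2} (h : 1 < vertexType g s) :
    vertexType g = lineType s (vertexType g s) := by
  funext t
  by_cases hst : t = s
  · rw [lineType, if_pos hst, hst]
  · rw [lineType, if_neg hst, vertexType_eq_one_of_one_lt (Ne.symm hst) h]

open Classical in
/-- Apart from the root, the sources are the vertices at a position greater than `1` and not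
divisible by `p s` in one of the directions `f s`. -/
theorem sum_sources_eq (hp : ∀ s, 2 ≤ p s) (F : (Fin 2 → ℕ) → ℕ → ℝ) (n : ℕ) :
    ∑ g ∈ ballFinset n with IsSource p g, F (vertexType g) (n - g.length) =
      F (vertexType 1) n + ∑ s, lineSum s (p s) (fun k i => F (lineType s i) k) n := by
  have h1 : F (vertexType 1) n =
      ∑ g ∈ ballFinset n, if g = 1 then F (vertexType g) (n - g.length) else 0 := by
    rw [Finset.sum_ite_eq' (ballFinset n) (1 : T2) fun g => F (vertexType g) (n - g.length),
      if_pos (mem_ballFinset.2 (Nat.zero_le _))]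
    rfl
  simp only [h1, lineSum, Finset.sum_filter]
  rw [Finset.sum_comm, ← Finset.sum_add_distrib]
  refine Finset.sum_congr rfl fun g _ => ?_
  have hpos := vertexType_pos g
  have hnd : ∀ s, vertexType g s = 1 → ¬ p s ∣ vertexType g s := fun s h1 h2 => by
    have := Nat.le_of_dvd one_pos (h1 ▸ h2)
    have := hp s
    omega
  by_cases hg : ∃ s, 1 < vertexType g s
  · obtain ⟨s, hs⟩ := hg
    have hother : ∀ t, t ≠ s → vertexType g t = 1 := fun t ht =>
      vertexType_eq_one_of_one_lt (Ne.symm ht) hs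
    have hne : g ≠ 1 := by
      rintro rfl
      exact absurd hs (by simp [vertexType_one])
    rw [if_neg hne, zero_add, Finset.sum_eq_single s
      (fun t _ ht => if_neg fun h => by rw [hother t ht] at h; omega)
      fun h => absurd (Finset.mem_univ s) h, ← vertexType_eq_lineType hs]
    refine if_congr ⟨fun h => ⟨hs, h s⟩, fun h t => ?_⟩ rfl rfl
    by_cases hts : t = s
    · exact hts ▸ h.2
    · exact hnd t (hother t hts)
  · push Not at hg
    have hone : ∀ s, vertexType g s = 1 := fun s => le_antisymm (hg s) (hpos s)
    rw [if_pos (show IsSource p g from fun s => hnd s (hone s)), if_pos (eq_one_of_vertexType hone),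
      Finset.sum_eq_zero fun s _ => if_neg fun h => by rw [hone s] at h; omega, add_zero]

/-! ### Convergence of the entropy series -/

/-- The dependent trees of the sources are disjoint, so that their traces on `Δₙ` together have at
most `|Δₙ|` elements. -/
theorem summable_ncard_shape (hp : ∀ s, 2 ≤ p s) (s : Fin 2) :
    Summable fun x : ℕ × {i : ℕ // 1 < i ∧ ¬ p s ∣ i} =>
      (1 : ℝ) / 2 ^ (x.1 + x.2.1 + 1) * (shape p (lineType s x.2) x.1).ncard := by
  classical
  refine summable_of_lineSum_le s (p s) (D := fun k i => (shape p (lineType s i) k).ncard)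
    (fun _ _ => Nat.cast_nonneg _) fun n => ?_
  have h1 := sum_sources_eq hp (fun τ k => ((shape p τ k).ncard : ℝ)) n
  have h2 := congrArg (Nat.cast (R := ℝ)) (sum_ncard_shape hp n)
  rw [Nat.cast_sum, h1] at h2
  have h3 : lineSum s (p s) (fun k i => ((shape p (lineType s i) k).ncard : ℝ)) n ≤
      ∑ s, lineSum s (p s) (fun k i => ((shape p (lineType s i) k).ncard : ℝ)) n :=
    Finset.single_le_sum
      (f := fun s => lineSum s (p s) (fun k i => ((shape p (lineType s i) k).ncard : ℝ)) n)
      (fun t _ => Finset.sum_nonneg fun g _ => Nat.cast_nonneg _) (Finset.mem_univ s)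
  have h4 : (0 : ℝ) ≤ (shape p (vertexType 1) n).ncard := Nat.cast_nonneg _
  linarith

/-- A summand is at most `log |A|` times the corresponding term of `summable_ncard_shape`. -/
theorem summable_entropyTerm {A : Type*} [Finite A] (hp : ∀ s, 2 ≤ p s)
    (Ω : Fin 2 → Set (ℕ → A)) (s : Fin 2) :
    Summable fun x : ℕ × {i : ℕ // 1 < i ∧ ¬ p s ∣ i} =>
      entropyTerm p Ω (lineType s x.2) x.2 x.1 := by
  refine Summable.of_nonneg_of_le
    (fun x => mul_nonneg (by positivity) (log_ncard_patterns_nonneg _ _)) (fun x => ?_)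
    ((summable_ncard_shape hp s).mul_right (Real.log (Nat.card A)))
  rw [mul_assoc]
  exact mul_le_mul_of_nonneg_left (log_ncard_patterns_le (finite_shape p hp _ _) _)
    (by positivity)

/-- The dependent tree of the root has density zero. It is covered by the shapes of the vertices
`f t ^ p t`, which are sources, and the density of each of these shapes tends to zero by
`summable_ncard_shape`. -/
theorem tendsto_ncard_shape_one_div (hp : ∀ s, 2 ≤ p s) :
    Tendsto (fun n => ((shape p (vertexType 1) n).ncard : ℝ) / (ball n).ncard) atTop (𝓝 0) := by
  have hline : ∀ t, vertexType (f t ^ p t) = lineType t (p t + 1) := by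
    intro t
    have h1 : vertexType (f t ^ p t) t = p t + 1 := by
      rw [← one_mul (f t ^ p t), vertexType_mul_f_pow_self, vertexType_one, add_comm]
    have := hp t
    rw [vertexType_eq_lineType (s := t) (by omega), h1]
  have hlim : ∀ t, Tendsto (fun n => ((shape p (lineType t (p t + 1)) n).ncard : ℝ) / 2 ^ n)
      atTop (𝓝 0) := by
    intro t
    have hq : 1 < p t + 1 ∧ ¬ p t ∣ p t + 1 := by
      have := hp t
      refine ⟨by omega, fun h => ?_⟩
      have := Nat.le_of_dvd one_pos ((Nat.dvd_add_right dvd_rfl).1 h)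
      omega
    have h1 := ((summable_ncard_shape hp t).comp_injective
      (i := fun k : ℕ => (k, (⟨p t + 1, hq⟩ : {i : ℕ // 1 < i ∧ ¬ p t ∣ i})))
      fun a b h => congrArg Prod.fst h).tendsto_atTop_zero.const_mul ((2 : ℝ) ^ (p t + 2))
    rw [mul_zero] at h1
    refine h1.congr fun n => ?_
    simp only [Function.comp]
    rw [show n + (p t + 1) + 1 = n + (p t + 2) by ring, pow_add 2 n]
    have : (2 : ℝ) ^ (p t + 2) ≠ 0 := pow_ne_zero _ two_ne_zero
    generalize (2 : ℝ) ^ (p t + 2) = c at *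
    field_simp
  have hone : Tendsto (fun n : ℕ => (1 : ℝ) / 2 ^ n) atTop (𝓝 0) := by
    simpa using tendsto_pow_atTop_nhds_zero_of_lt_one (r := (1 / 2 : ℝ)) (by norm_num)
      (by norm_num)
  have hbound := hone.add ((hlim 1).add (hlim 0))
  rw [add_zero, add_zero] at hbound
  refine squeeze_zero (fun n => by positivity) (fun n => ?_) hbound
  -- The vertex `f 1 ^ p 1` begins a line in the direction `f 0`, and conversely.
  have hcover := dependentShape_one_subset hp ![f 1 ^ p 1, f 0 ^ p 0] (by
    intro s
    fin_cases s
    · exact congrFun (hline 1) 0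
    · exact congrFun (hline 0) 1) n
  simp only [← shape_eq_dependentShape, Matrix.cons_val_zero, Matrix.cons_val_one, hline] at hcover
  have hcard := (Set.ncard_le_ncard hcover ((Set.finite_singleton _).union
    ((finite_shape p hp _ _).union (finite_shape p hp _ _)))).trans
    ((Set.ncard_union_le _ _).trans (Nat.add_le_add_left (Set.ncard_union_le _ _) _))
  rw [Set.ncard_singleton] at hcard
  have hcard' : ((shape p (vertexType 1) n).ncard : ℝ) ≤
      1 + ((shape p (lineType 1 (p 1 + 1)) n).ncard +
        (shape p (lineType 0 (p 0 + 1)) n).ncard) := by exact_mod_cast hcard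
  rw [← add_div, ← add_div]
  exact div_le_div₀ (by positivity) hcard' (by positivity) (two_pow_le_ncard_ball n)

theorem hasTreeEntropy_multAxialProduct {A : Type*} [Finite A] (hp : ∀ s, 2 ≤ p s)
    {Ω : Fin 2 → Set (ℕ → A)} (hΩ : ∀ s (m : ℕ), ∀ x ∈ Ω s, (fun n => x (m + n)) ∈ Ω s) :
    HasTreeEntropy (multAxialProduct fun s => multSubshift (p s) (Ω s))
      (∑ s, ∑' k : ℕ, ∑' i : {i : ℕ // 1 < i ∧ ¬ p s ∣ i},
        entropyTerm p Ω (lineType s i) i k) := by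
  classical
  let L : (Fin 2 → ℕ) → ℕ → ℝ := fun τ k =>
    Real.log ((patterns (shape p τ k) (axialProduct Ω)).ncard : ℝ)
  have hL : ∀ τ k, 0 ≤ L τ k := fun τ k => log_ncard_patterns_nonneg _ _
  have hroot : Tendsto (fun n => L (vertexType 1) n / (ball n).ncard) atTop (𝓝 0) := by
    have := (tendsto_ncard_shape_one_div hp).mul_const (Real.log (Nat.card A))
    rw [zero_mul] at this
    refine squeeze_zero (fun n => div_nonneg (hL _ _) (Nat.cast_nonneg _)) (fun n => ?_) this
    rw [div_mul_eq_mul_div]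
    exact div_le_div_of_nonneg_right (log_ncard_patterns_le (finite_shape p hp _ _) _)
      (Nat.cast_nonneg _)
  have hlines := tendsto_finsetSum Finset.univ fun s _ =>
    (summable_entropyTerm hp Ω s).tsum_prod ▸
      tendsto_lineSum_div s (p s) (F := fun k i => L (lineType s i) k) (fun k i => hL _ k)
        (summable_entropyTerm hp Ω s)
  have htotal := hroot.add hlines
  rw [zero_add] at htotal
  refine htotal.congr fun n => ?_
  rw [log_ncard_patterns_ball hp hΩ, sum_sources_eq hp L, add_div, Finset.sum_div]

theorem cons_one_eq_lineType (i : ℕ) : ![i, 1] = lineType 0 i := by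
  funext t
  fin_cases t <;> rfl

theorem one_cons_eq_lineType (i : ℕ) : ![1, i] = lineType 1 i := by
  funext t
  fin_cases t <;> rfl

end AxialProduct

end

theorem mainTheorem2 {A : Type*} [Finite A] [TopologicalSpace A] [DiscreteTopology A]
    (Ω₁ Ω₂ : SymbolicDynamics.FullShift.Subshift A ℕ) (p₁ p₂ : ℕ) (hp₁ : 2 ≤ p₁) (hp₂ : 2 ≤ p₂) :
    Summable (fun x : ℕ × {i : ℕ // 1 < i ∧ ¬ p₁ ∣ i} =>
      AxialProduct.entropyTerm ![p₁, p₂] ![Ω₁.carrier, Ω₂.carrier] ![x.2, 1] x.2 x.1) ∧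
    Summable (fun x : ℕ × {j : ℕ // 1 < j ∧ ¬ p₂ ∣ j} =>
      AxialProduct.entropyTerm ![p₁, p₂] ![Ω₁.carrier, Ω₂.carrier] ![1, x.2] x.2 x.1) ∧
    AxialProduct.HasTreeEntropy
      (AxialProduct.multAxialProduct
        ![AxialProduct.multSubshift p₁ Ω₁.carrier, AxialProduct.multSubshift p₂ Ω₂.carrier])
      ((∑' k : ℕ, ∑' i : {i : ℕ // 1 < i ∧ ¬ p₁ ∣ i},
          AxialProduct.entropyTerm ![p₁, p₂] ![Ω₁.carrier, Ω₂.carrier] ![i, 1] i k) +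
        ∑' k : ℕ, ∑' j : {j : ℕ // 1 < j ∧ ¬ p₂ ∣ j},
          AxialProduct.entropyTerm ![p₁, p₂] ![Ω₁.carrier, Ω₂.carrier] ![1, j] j k) := by
  have hp : ∀ s, 2 ≤ ![p₁, p₂] s := Fin.forall_fin_two.2 ⟨hp₁, hp₂⟩
  have hΩ : ∀ s (m : ℕ), ∀ x ∈ ![Ω₁.carrier, Ω₂.carrier] s,
      (fun n => x (m + n)) ∈ ![Ω₁.carrier, Ω₂.carrier] s :=
    Fin.forall_fin_two.2 ⟨fun m _ hx => Ω₁.mapsTo m hx, fun m _ hx => Ω₂.mapsTo m hx⟩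
  have hX : ![AxialProduct.multSubshift p₁ Ω₁.carrier, AxialProduct.multSubshift p₂ Ω₂.carrier] =
      fun s => AxialProduct.multSubshift (![p₁, p₂] s) (![Ω₁.carrier, Ω₂.carrier] s) := by
    funext s
    fin_cases s <;> rfl
  have h := AxialProduct.hasTreeEntropy_multAxialProduct hp hΩ
  rw [Fin.sum_univ_two] at h
  simp only [AxialProduct.cons_one_eq_lineType, AxialProduct.one_cons_eq_lineType, hX]
  exact ⟨AxialProduct.summable_entropyTerm hp _ 0, AxialProduct.summable_entropyTerm hp _ 1, h⟩
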